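/- Let $\{\varphi_e\}_{e\in\mathbb N}$ be the standard enumeration of the partial computable functions $\mathbb N\to\mathbb N$, and let $\mathbb B=\mathbb N^{\mathbb N}$ be Baire space. In a space $\mathcal X$ whose points have *Type-2 names* in $\mathbb B$, a point is *computable* if it has a computable Type-2 name, and $X_c$ is the set of computable points. For $x\in X_c$: - a *Markov name* of $x$ is a number $e$ such that $\varphi_e$ is total and is a Type-2 name of $x$; - the *Kolmogorov complexity* $K(x)$ is the length of a shortest binary program (for a fixed universal machine) that computes a Type-2 name of $x$; - a *K-name* of $x$ is a pair $(k,f)$ where $k\in\mathbb N$, $k\ge K(x)$ and $f$ is a (not necessarily computable) Type-2 name of $x$. For each of the three kinds R of names, a function $F:X_c\to Y_c$ is *R-computable* if there is a Turing machine which, when provided with any R-name of any $x\in X_c$, outputs an R-name of $F(x)$ (with the infinite names on input and output tapes). We consider two spaces. A Type-2 name of a set $A$ in the space $\mathcal P(\mathbb N)$ of subsets of $\mathbb N$, with the Scott topology, is an enumeration of all (indices of) finite sets $D\subseteq A$; so $\mathcal P(\mathbb N)_c$ consists of the c.e. sets. $\mathcal O(\mathbb B)$ is the space of open subsets of $\mathbb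 B$, with the (not countably based) topology generated by the classes $\{U : K\subseteq U\}$ for $K\subseteq\mathbb B$ compact; a Type-2 name of $U\in\mathcal O(\mathbb B)$ is a (possibly empty) list of cylinders whose union is $U$ (this is an admissible representation of $\mathcal O(\mathbb B)$). **Theorem.** For functions $F:\mathcal P(\mathbb N)_c\to\mathcal O(\mathbb B)_c$, Markov-computability is strictly stronger than K-computability, which is strictly stronger than Type-2 computability. That is: 1. every K-computable $F$ is Markov-computable, and some Markov-computable $F$ is not K-computable; 2. every Type-2 computable $F$ is K-computable, and some K-computable $F$ is not Type-2 computable. -/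

import Mathlib

namespace NamedSpaces

/-- Baire space `ℕ^ℕ`, with the product of the discrete topologies. -/
abbrev Baire : Type := ℕ → ℕ

/-- A naming of the points of `X` by elements of Baire space: `δ f x` means that `f` is a Type-2 name
of `x`. -/
abbrev Naming (X : Type*) : Type _ := Baire → X → Prop

/-! ### Machines with an infinite input tape -/

/-- The Turing functionals: partial functions that are recursive in an oracle `f`, by a program that
does not depend on `f`. The clauses are those of Mathlib's `Nat.RecursiveIn`, uniformly in the oracle.
`Φ f n` is the `n`-th entry that the machine writes when `f` is on the input tape. -/
inductive TuringFunctional : (Baire → ℕ →. ℕ) → Prop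
  | zero : TuringFunctional fun _ _ => Part.some 0
  | succ : TuringFunctional fun _ n => Part.some (n + 1)
  | left : TuringFunctional fun _ n => Part.some (Nat.unpair n).1
  | right : TuringFunctional fun _ n => Part.some (Nat.unpair n).2
  | oracle : TuringFunctional fun f n => Part.some (f n)
  | pair {Φ Ψ : Baire → ℕ →. ℕ} (hΦ : TuringFunctional Φ) (hΨ : TuringFunctional Ψ) :
      TuringFunctional fun f n => Nat.pair <$> Φ f n <*> Ψ f n
  | comp {Φ Ψ : Baire → ℕ →. ℕ} (hΦ : TuringFunctional Φ) (hΨ : TuringFunctional Ψ) :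
      TuringFunctional fun f n => Ψ f n >>= Φ f
  | prec {Φ Ψ : Baire → ℕ →. ℕ} (hΦ : TuringFunctional Φ) (hΨ : TuringFunctional Ψ) :
      TuringFunctional fun f p =>
        let (a, n) := Nat.unpair p
        n.rec (Φ f a) fun y IH => do
          let i ← IH
          Ψ f (Nat.pair a (Nat.pair y i))
  | rfind {Φ : Baire → ℕ →. ℕ} (hΦ : TuringFunctional Φ) :
      TuringFunctional fun f a =>
        Nat.rfind fun n => (fun m => decide (m = 0)) <$> Φ f (Nat.pair a n)

/-! ### Type-2 names, Markov names and K-names -/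

section Names

variable {X : Type*}

/-- The computable points: those with a computable Type-2 name. -/
def ComputablePoint (δ : Naming X) : Type _ :=
  {x : X // ∃ f : Baire, Computable f ∧ δ f x}

/-- `φ_e`, for Mathlib's effective enumeration of the partial recursive functions. -/
def phi (e : ℕ) : ℕ →. ℕ :=
  (Denumerable.ofNat Nat.Partrec.Code e).eval

/-- `e` is a Markov name of `x`: `φ_e` is total and is a Type-2 name of `x`. -/
def MarkovName (δ : Naming X) (e : ℕ) (x : X) : Prop :=
  ∃ f : Baire, (∀ n, f n ∈ phi e n) ∧ δ f x

/-- Splits a binary word `1^e 0 v` into `e` and `v` (and `1^e` into `e` and the empty word). -/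
def splitProgram : List Bool → ℕ × List Bool
  | [] => (0, [])
  | false :: v => (0, v)
  | true :: w => ((splitProgram w).1 + 1, (splitProgram w).2)

/-- The additively optimal (plain) universal machine: on the program `1^e 0 v` it runs the machine
`φ_e` with the word `v` as its program. -/
def universal (w : List Bool) (n : ℕ) : Part ℕ :=
  phi (splitProgram w).1 (Nat.pair (Encodable.encode (splitProgram w).2) n)

/-- The binary program `w` computes a Type-2 name of `x`. -/
def ProgramFor (δ : Naming X) (w : List Bool) (x : X) : Prop :=
  ∃ f : Baire, (∀ n, f n ∈ universal w n) ∧ δ f x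

/-- The Kolmogorov complexity `K(x)`: the length of a shortest program that computes a Type-2 name of
`x`. It is `⊤` if `x` is not computable. -/
noncomputable def complexity (δ : Naming X) (x : X) : ℕ∞ :=
  ⨅ (w : List Bool) (_ : ProgramFor δ w x), (w.length : ℕ∞)

/-- K-names: pairs `(k, f)` with `k ≥ K(x)` and `f` a Type-2 name of `x` (not necessarily a
computable one). The pair is written as the sequence `k, f 0, f 1, …`. -/
def KName (δ : Naming X) : Naming X := fun h x =>
  complexity δ x ≤ (h 0 : ℕ∞) ∧ δ (fun n => h (n + 1)) x

end Names

/-! ### Three notions of computability for functions `X_c → Y_c` -/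

section Functions

variable {X Y : Type*}

/-- A machine maps every Type-2 name of `x` to a Type-2 name of `F x`. -/
def Type2Computable (δ : Naming X) (γ : Naming Y)
    (F : ComputablePoint δ → ComputablePoint γ) : Prop :=
  ∃ Φ : Baire → ℕ →. ℕ, TuringFunctional Φ ∧
    ∀ (f : Baire) (x : ComputablePoint δ), δ f x.1 →
      ∃ g : Baire, (∀ n, g n ∈ Φ f n) ∧ γ g (F x).1

/-- A machine maps every K-name of `x` to a K-name of `F x`. -/
def KComputable (δ : Naming X) (γ : Naming Y)
    (F : ComputablePoint δ → ComputablePoint γ) : Prop :=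
  ∃ Φ : Baire → ℕ →. ℕ, TuringFunctional Φ ∧
    ∀ (f : Baire) (x : ComputablePoint δ), KName δ f x.1 →
      ∃ g : Baire, (∀ n, g n ∈ Φ f n) ∧ KName γ g (F x).1

/-- A machine maps every Markov name of `x` to a Markov name of `F x`. -/
def MarkovComputable (δ : Naming X) (γ : Naming Y)
    (F : ComputablePoint δ → ComputablePoint γ) : Prop :=
  ∃ φ : ℕ →. ℕ, Nat.Partrec φ ∧
    ∀ (e : ℕ) (x : ComputablePoint δ), MarkovName δ e x.1 →
      ∃ e' ∈ φ e, MarkovName γ e' (F x).1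

end Functions

/-! ### The space `P(ℕ)` -/

/-- The standard representation for a numbered basis: `f` is a name of `x` if it enumerates the
indices of all basic open sets that contain `x`. -/
def standardNaming {X : Type*} (B : ℕ → Set X) : Naming X := fun f x =>
  Set.range f = {i | x ∈ B i}

/-- The numbered basis of the Scott topology of `P(ℕ)`: the sets `[D]` of all supersets of `D`, for the
finite set `D` of the entries of the `i`-th list of natural numbers. -/
def scottBasis (i : ℕ) : Set (Set ℕ) :=
  {A | ∀ n ∈ Denumerable.ofNat (List ℕ) i, n ∈ A}

/-- Type-2 names in `P(ℕ)`. -/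
def powerNaming : Naming (Set ℕ) :=
  standardNaming scottBasis

/-! ### The space `O(𝔹)` -/

/-- The cylinder `[u]`: all infinite sequences with the finite prefix `u`. -/
def cylinder (u : List ℕ) : Set Baire :=
  {g | (List.range u.length).map g = u}

/-- Type-2 names in `O(𝔹)`: `f` lists cylinders with union `U`. The entry `0` lists nothing, and the
entry `i + 1` lists the cylinder of the `i`-th finite sequence. -/
def openNaming : Naming (TopologicalSpace.Opens Baire) := fun f U =>
  ∀ g : Baire, g ∈ U ↔
    ∃ (n : ℕ) (u : List ℕ), f n = Encodable.encode u + 1 ∧ g ∈ cylinder u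

/-- The topology of `O(𝔹)`: for each compact `K ⊆ 𝔹`, the class of the open sets that contain `K` is
open. -/
@[reducible] def opensTopology : TopologicalSpace (TopologicalSpace.Opens Baire) :=
  TopologicalSpace.generateFrom
    {S | ∃ K : Set Baire, IsCompact K ∧ S = {U : TopologicalSpace.Opens Baire | K ⊆ U}}

theorem mem_cylinder_iff {u : List ℕ} {g : Baire} :
    g ∈ cylinder u ↔ ∀ i (h : i < u.length), g i = u[i] := by
  constructor
  · intro h i hi
    have h' : (List.range u.length).map g = u := h
    have := congrArg (fun l : List ℕ => l[i]?) h'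
    simpa [hi] using this
  · intro h
    refine List.ext_getElem (by simp) ?_
    intro i h1 h2
    simpa using h i h2

theorem isClopen_cylinder (u : List ℕ) : IsClopen (cylinder u) := by
  have : cylinder u = ⋂ i : Fin u.length, (fun g : Baire => g i) ⁻¹' {u[i]} := by
    ext g
    simp only [mem_cylinder_iff, Set.mem_iInter, Set.mem_preimage, Set.mem_singleton_iff]
    exact ⟨fun h i => h i i.2, fun h i hi => h ⟨i, hi⟩⟩
  rw [this]
  exact isClopen_iInter_of_finite fun i =>
    (isClopen_discrete _).preimage (continuous_apply _)

/-- `δ` is an admissible representation of the space `(X, τ)`: a name determines the point, `δ` is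
continuous on the set of names, and every continuous map from a subspace of Baire space to `X` lifts
continuously through `δ`. -/
def Admissible {X : Type*} (τ : TopologicalSpace X) (δ : Naming X) : Prop :=
  (∀ f x y, δ f x → δ f y → x = y) ∧
  (∀ φ : {f : Baire // ∃ x, δ f x} → X, (∀ f, δ f.1 (φ f)) → Continuous φ) ∧
  (∀ (D : Set Baire) (φ : D → X), Continuous φ →
    ∃ G : D → Baire, Continuous G ∧ ∀ d, δ (G d) (φ d))

/-- Listing cylinders is an admissible representation of `O(𝔹)`. -/
theorem openNaming_admissible : Admissible opensTopology openNaming := by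
  classical
  refine ⟨fun f U V hU hV => TopologicalSpace.Opens.ext (Set.ext fun g => (hU g).trans (hV g).symm),
    ?_, ?_⟩
  · intro φ hφ
    refine continuous_generateFrom_iff.2 ?_
    rintro _ ⟨K, hK, rfl⟩
    rw [isOpen_iff_mem_nhds]
    intro f hf
    let C : ℕ → Set Baire := fun n =>
      ⋃ (u : List ℕ) (_ : f.1 n = Encodable.encode u + 1), cylinder u
    have hC : ∀ n, IsOpen (C n) := fun n =>
      isOpen_iUnion fun u => isOpen_iUnion fun _ => (isClopen_cylinder u).isOpen
    have hcov : K ⊆ ⋃ n, C n := by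
      intro g hg
      obtain ⟨n, u, h1, h2⟩ := (hφ f g).1 (hf hg)
      exact Set.mem_iUnion.2 ⟨n, Set.mem_iUnion₂.2 ⟨u, h1, h2⟩⟩
    obtain ⟨t, ht⟩ := hK.elim_finite_subcover C hC hcov
    have hopen : IsOpen {f' : {f : Baire // ∃ x, openNaming f x} | ∀ n ∈ t, f'.1 n = f.1 n} := by
      have : {f' : {f : Baire // ∃ x, openNaming f x} | ∀ n ∈ t, f'.1 n = f.1 n} =
          ⋂ n ∈ t, (fun f' : {f : Baire // ∃ x, openNaming f x} => f'.1 n) ⁻¹' {f.1 n} := by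
        ext f'; simp
      rw [this]
      exact isOpen_biInter_finset fun n _ =>
        (isOpen_discrete _).preimage ((continuous_apply n).comp continuous_subtype_val)
    refine Filter.mem_of_superset (hopen.mem_nhds (fun n _ => rfl)) ?_
    intro f' hf' g hg
    obtain ⟨n, hn, hgn⟩ := Set.mem_iUnion₂.1 (ht hg)
    obtain ⟨u, h1, h2⟩ := Set.mem_iUnion₂.1 hgn
    exact (hφ f' g).2 ⟨n, u, (hf' n hn).trans h1, h2⟩
  · intro D φ hφ
    have key : ∀ (d : D) (x : Baire), x ∈ φ d → ∃ u v : List ℕ, d.1 ∈ cylinder u ∧ x ∈ cylinder v ∧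
        ∀ d' : D, d'.1 ∈ cylinder u → ∀ x' ∈ cylinder v, x' ∈ φ d' := by
      intro d x hx
      by_contra hcon
      push Not at hcon
      have hpre : ∀ (z : Baire) (n : ℕ), z ∈ cylinder ((List.range n).map z) := by
        intro z n; simp [cylinder]
      choose d' hd' x' hx' hnot using fun n : ℕ =>
        hcon ((List.range n).map d.1) ((List.range n).map x) (hpre _ _) (hpre _ _)
      have hlim : ∀ (z : Baire) (s : ℕ → Baire), (∀ n, s n ∈ cylinder ((List.range n).map z)) →
          Filter.Tendsto s Filter.atTop (nhds z) := by
        intro z s hs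
        rw [tendsto_pi_nhds]
        intro i
        refine tendsto_const_nhds.congr' ?_
        filter_upwards [Filter.eventually_gt_atTop i] with n hn
        have := mem_cylinder_iff.1 (hs n) i (by simpa using hn)
        simpa using this.symm
      have hx'lim := hlim x x' hx'
      have hd'lim : Filter.Tendsto d' Filter.atTop (nhds d) :=
        tendsto_subtype_rng.2 (hlim d.1 (fun n => (d' n).1) hd')
      obtain ⟨N, hN⟩ := Filter.eventually_atTop.1
        (hx'lim.eventually ((φ d).isOpen.mem_nhds hx))
      let K : Set Baire := insert x (Set.range fun n => x' (n + N))
      have hK : IsCompact K :=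
        ((Filter.tendsto_add_atTop_iff_nat N).2 hx'lim).isCompact_insert_range
      have hKo : IsOpen (φ ⁻¹' {U : TopologicalSpace.Opens Baire | K ⊆ U}) :=
        continuous_generateFrom_iff.1 hφ _ ⟨K, hK, rfl⟩
      have hKd : K ⊆ φ d := by
        rintro z (rfl | ⟨n, rfl⟩)
        · exact hx
        · exact hN _ (Nat.le_add_left _ _)
      obtain ⟨M, hM⟩ := Filter.eventually_atTop.1 (hd'lim.eventually (hKo.mem_nhds hKd))
      exact hnot (M + N) (hM (M + N) (Nat.le_add_right _ _) (Or.inr ⟨M, rfl⟩))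
    let P : List ℕ → List ℕ → Prop := fun u v =>
      ∀ d' : D, d'.1 ∈ cylinder u → ∀ x' ∈ cylinder v, x' ∈ φ d'
    let dec : ℕ → List ℕ × List ℕ := Denumerable.ofNat (List ℕ × List ℕ)
    let G : D → Baire := fun d n =>
      if d.1 ∈ cylinder (dec n).1 ∧ P (dec n).1 (dec n).2 then Encodable.encode (dec n).2 + 1 else 0
    refine ⟨G, continuous_pi fun n => ?_, fun d x => ⟨fun hx => ?_, ?_⟩⟩
    · refine (IsLocallyConstant.iff_exists_open _).2 (fun d => ?_) |>.continuous
      have hcl : IsClopen ((Subtype.val : D → Baire) ⁻¹' cylinder (dec n).1) :=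
        (isClopen_cylinder _).preimage continuous_subtype_val
      by_cases hd : d.1 ∈ cylinder (dec n).1
      · refine ⟨_, hcl.isOpen, hd, fun d' hd' => ?_⟩
        have hd'' : d'.1 ∈ cylinder (dec n).1 := hd'
        simp [G, hd, hd'']
      · refine ⟨_, hcl.compl.isOpen, hd, fun d' hd' => ?_⟩
        have hd'' : d'.1 ∉ cylinder (dec n).1 := hd'
        simp [G, hd, hd'']
    · obtain ⟨u, v, h1, h2, h3⟩ := key d x hx
      refine ⟨Encodable.encode (u, v), v, ?_, h2⟩
      have : dec (Encodable.encode (u, v)) = (u, v) := Denumerable.ofNat_encode _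
      simp only [G, this]
      exact if_pos ⟨h1, h3⟩
    · rintro ⟨n, v, h1, h2⟩
      by_cases hc : d.1 ∈ cylinder (dec n).1 ∧ P (dec n).1 (dec n).2
      · have h4 : Encodable.encode (dec n).2 + 1 = Encodable.encode v + 1 := by
          rw [← h1]; exact (if_pos hc).symm
        have h5 : (dec n).2 = v := Encodable.encode_injective (Nat.succ_injective h4)
        exact hc.2 d hc.1 x (h5 ▸ h2)
      · have : G d n = 0 := if_neg hc
        omega

end NamedSpaces

/-!
**The implications.** A machine run on an input that is computable uniformly in a parameter computes
a function that is partial recursive uniformly in the parameter (`TuringFunctional.exists_partrec`).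
So a program for `x` becomes, at the cost of a constant, a program for `F x` (`Type2Computable.kComputable`),
and a Markov name `e` of `x` yields both a bound for `K(x)` and a name of `x`, from which a K-machine
computes an index of `F x` (`KComputable.markovComputable`).

**The separations.** Both functions send `ℕ` to all of Baire space, and send a c.e. set `A ≠ ℕ` to an
open set that depends on the least missing number `m` only (`target`). Let `ρ e 0 ≤ ρ e 1 ≤ …` be the
lengths of the initial segments enumerated by the program `e` after `s` steps. The image of `A`
contains the `g` such that, for some `e`, the numbers `ρ e s` exceed an entry `g j` (the program
*accepts* `g` with witness `j`) and then rest at a value `≤ m` for the waiting time `g s`. A program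
for `A` may list whatever it accepts: if `A ≠ ℕ`, it comes to rest at `m`, so that what it accepts is in
the image of `A` in any case (`mem_target_of_accepts`).

For K-computability the witness `j` may be any bound for the length of `e`. The K-machine then
accepts `g` once the initial segment exceeds `g k`, for the given bound `k`. A sequence `G` that grows
fast enough (`Outgrows`) is in the image of no `A ≠ ℕ`, but in that of `ℕ`; a Type-2 machine would
have to list a neighbourhood of `G` after reading finitely many elements of `ℕ`.

For Markov computability, `j` must be at least `e`, and `ρ e j` must exceed `g e`: the program
uses its own index to choose the place at which it reads `g`. Suppose that a K-machine computes this
function. On `ℕ` it lists a cylinder `u` around an outgrowing `G`, after reading only elements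
`< m` of `ℕ`. A short program can find some such `u` and `m`, with the extra property that the finitely
many programs that choose their witness within `u` are already known to pass beyond `m`
(`Harmless`); prefixes of `G` have this property in the end. All later witnesses can be made
harmless by continuing `u` with an outgrowing sequence (`Outgrows.exists_not_settles`). This
continuation is not in the image of `{0, …, m - 1}`, a set of low complexity for which the K-machine
lists `u` as well.
-/

namespace NamedSpaces

/-! ### Turing functionals -/

namespace TuringFunctional

theorem of_partrec {h : ℕ →. ℕ} (hh : Nat.Partrec h) : TuringFunctional fun _ n => h n := by
  induction hh with
  | zero => exact .zero
  | succ => exact .succ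
  | left => exact .left
  | right => exact .right
  | pair _ _ ih₁ ih₂ => exact .pair ih₁ ih₂
  | comp _ _ ih₁ ih₂ => exact .comp ih₁ ih₂
  | prec _ _ ih₁ ih₂ => exact .prec ih₁ ih₂
  | rfind _ ih => exact .rfind ih

theorem of_computable {h : ℕ → ℕ} (hh : Computable h) :
    TuringFunctional fun _ n => Part.some (h n) :=
  of_partrec (Partrec.nat_iff.1 hh.partrec)

/-- Reading the input tape at a computable place. -/
theorem read {a : ℕ → ℕ} (ha : Computable a) :
    TuringFunctional fun f n => Part.some (f (a n)) := by
  have := TuringFunctional.comp .oracle (of_computable ha)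
  simpa using this

theorem pair_some {a b : Baire → ℕ → ℕ} (ha : TuringFunctional fun f n => Part.some (a f n))
    (hb : TuringFunctional fun f n => Part.some (b f n)) :
    TuringFunctional fun f n => Part.some (Nat.pair (a f n) (b f n)) := by
  have := TuringFunctional.pair ha hb
  simpa [Seq.seq] using this

theorem map_some {h : ℕ → ℕ} (hh : Computable h) {a : Baire → ℕ → ℕ}
    (ha : TuringFunctional fun f n => Part.some (a f n)) :
    TuringFunctional fun f n => Part.some (h (a f n)) := by
  have := TuringFunctional.comp (of_computable hh) ha
  simpa using this

/-- Deleting the first entry of the input tape. -/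
theorem tail {Φ : Baire → ℕ →. ℕ} (h : TuringFunctional Φ) :
    TuringFunctional fun f n => Φ (fun i => f (i + 1)) n := by
  induction h with
  | zero => exact .zero
  | succ => exact .succ
  | left => exact .left
  | right => exact .right
  | oracle => exact read Computable.succ
  | pair _ _ ih₁ ih₂ => exact .pair ih₁ ih₂
  | comp _ _ ih₁ ih₂ => exact .comp ih₁ ih₂
  | prec _ _ ih₁ ih₂ => exact .prec ih₁ ih₂
  | rfind _ ih => exact .rfind ih

/-- Prefixing the output tape by an entry computed from the input. The recursion that does this is
defined at `n + 1` only if it is defined at the arguments below; hence the hypothesis on `g`. -/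
theorem cons {Φ : Baire → ℕ →. ℕ} (h : TuringFunctional Φ) {b : Baire → ℕ}
    (hb : TuringFunctional fun f _ => Part.some (b f)) :
    ∃ Ψ : Baire → ℕ →. ℕ, TuringFunctional Ψ ∧ ∀ f g : Baire, (∀ n, g n ∈ Φ f n) →
      ∀ n, (Nat.casesOn n (b f) g : ℕ) ∈ Ψ f n := by
  have hy : Computable fun p : ℕ => p.unpair.2.unpair.1 :=
    Computable.fst.comp (Computable.unpair.comp (Computable.snd.comp Computable.unpair))
  have hz : Computable fun n : ℕ => Nat.pair 0 n :=
    (Primrec₂.natPair.comp (Primrec.const 0) Primrec.id).to_comp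
  refine ⟨_, .comp (.prec hb (.comp h (of_computable hy))) (of_computable hz), ?_⟩
  intro f g hg n
  simp only [Part.bind_eq_bind, Part.bind_some, Nat.unpair_pair]
  induction n with
  | zero => simp
  | succ n ih =>
    refine Part.mem_bind ih ?_
    exact Part.mem_bind (Part.mem_some n) (hg n)

/-- The use principle: a halting computation reads a finite part of the input. -/
theorem exists_use {Φ : Baire → ℕ →. ℕ} (h : TuringFunctional Φ) {f : Baire} {n v : ℕ}
    (hv : v ∈ Φ f n) : ∃ N, ∀ f' : Baire, (∀ i < N, f' i = f i) → v ∈ Φ f' n := by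
  induction h generalizing n v with
  | zero => exact ⟨0, fun _ _ => hv⟩
  | succ => exact ⟨0, fun _ _ => hv⟩
  | left => exact ⟨0, fun _ _ => hv⟩
  | right => exact ⟨0, fun _ _ => hv⟩
  | oracle => exact ⟨n + 1, fun f' hf' => by simpa [hf' n (Nat.lt_succ_self n)] using hv⟩
  | pair _ _ ih₁ ih₂ =>
    simp only [Seq.seq, Part.map_eq_map, Part.mem_bind_iff, Part.mem_map_iff,
      exists_exists_and_eq_and] at hv ⊢
    obtain ⟨a, ha, b, hb, hab⟩ := hv
    obtain ⟨N₁, h₁⟩ := ih₁ ha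
    obtain ⟨N₂, h₂⟩ := ih₂ hb
    exact ⟨max N₁ N₂, fun f' hf' => ⟨a, h₁ f' fun i hi => hf' i (lt_max_of_lt_left hi), b,
      h₂ f' fun i hi => hf' i (lt_max_of_lt_right hi), hab⟩⟩
  | comp _ _ ih₁ ih₂ =>
    obtain ⟨a, ha, hb⟩ := Part.mem_bind_iff.1 hv
    obtain ⟨N₁, h₁⟩ := ih₂ ha
    obtain ⟨N₂, h₂⟩ := ih₁ hb
    exact ⟨max N₁ N₂, fun f' hf' => Part.mem_bind_iff.2
      ⟨a, h₁ f' fun i hi => hf' i (lt_max_of_lt_left hi),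
      h₂ f' fun i hi => hf' i (lt_max_of_lt_right hi)⟩⟩
  | prec _ _ ih₁ ih₂ =>
    dsimp only at hv ⊢
    generalize n.unpair.2 = y at hv ⊢
    induction y generalizing v with
    | zero => exact ih₁ hv
    | succ y ih =>
      simp only [Part.bind_eq_bind, Part.mem_bind_iff] at hv ⊢
      obtain ⟨a, ha, hb⟩ := hv
      obtain ⟨N₁, h₁⟩ := ih ha
      obtain ⟨N₂, h₂⟩ := ih₂ hb
      exact ⟨max N₁ N₂, fun f' hf' => ⟨a, h₁ f' fun i hi => hf' i (lt_max_of_lt_left hi),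
        h₂ f' fun i hi => hf' i (lt_max_of_lt_right hi)⟩⟩
  | rfind _ ih =>
    have hv' := Nat.mem_rfind.1 hv
    have key : ∀ j ≤ v, ∃ N, ∀ f' : Baire, (∀ i < N, f' i = f i) → decide (j = v) ∈
        ((fun m => decide (m = 0)) <$> (‹Baire → ℕ →. ℕ› f' (Nat.pair n j)) : Part Bool) := by
      intro j hj
      have : decide (j = v) ∈ ((fun m => decide (m = 0)) <$>
          (‹Baire → ℕ →. ℕ› f (Nat.pair n j)) : Part Bool) := by
        rcases hj.eq_or_lt with rfl | hlt
        · simpa using hv'.1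
        · simpa [hlt.ne] using hv'.2 hlt
      simp only [Part.map_eq_map, Part.mem_map_iff] at this ⊢
      obtain ⟨m, hm, hmv⟩ := this
      obtain ⟨N, hN⟩ := ih hm
      exact ⟨N, fun f' hf' => ⟨m, hN f' hf', hmv⟩⟩
    choose! N hN using key
    refine ⟨(Finset.range (v + 1)).sup N, fun f' hf' => Nat.mem_rfind.2 ?_⟩
    have hk : ∀ j ≤ v, ∀ i < N j, f' i = f i := fun j hj i hi => hf' i
      (hi.trans_le (Finset.le_sup (f := N) (Finset.mem_range.2 (Nat.lt_succ_of_le hj))))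
    refine ⟨by simpa using hN v le_rfl f' (hk v le_rfl), fun {j} hj => ?_⟩
    simpa [hj.ne] using hN j hj.le f' (hk j hj.le)

/-- A machine whose input is computable, uniformly in a parameter, computes a function that is
partial recursive uniformly in the parameter. -/
theorem exists_partrec {P : Type*} [Primcodable P] {Φ : Baire → ℕ →. ℕ} (h : TuringFunctional Φ)
    {H : P → ℕ →. ℕ} (hH : Partrec₂ H) :
    ∃ ψ : P → ℕ →. ℕ, Partrec₂ ψ ∧
      ∀ (p : P) (f : Baire), (∀ n, f n ∈ H p n) → ∀ n, ψ p n = Φ f n := by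
  induction h with
  | zero => exact ⟨fun _ _ => Part.some 0, (Computable.const 0).partrec, fun _ _ _ _ => rfl⟩
  | succ => exact ⟨fun _ n => Part.some (n + 1), (Computable.succ.comp Computable.snd).partrec,
      fun _ _ _ _ => rfl⟩
  | left => exact ⟨fun _ n => Part.some n.unpair.1,
      (Computable.fst.comp (Computable.unpair.comp Computable.snd)).partrec, fun _ _ _ _ => rfl⟩
  | right => exact ⟨fun _ n => Part.some n.unpair.2,
      (Computable.snd.comp (Computable.unpair.comp Computable.snd)).partrec, fun _ _ _ _ => rfl⟩
  | oracle => exact ⟨H, hH, fun p f hf n => Part.eq_some_iff.2 (hf n)⟩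
  | pair _ _ ih₁ ih₂ =>
    obtain ⟨ψ₁, h₁, e₁⟩ := ih₁
    obtain ⟨ψ₂, h₂, e₂⟩ := ih₂
    refine ⟨fun p n => (ψ₁ p n).bind fun a => (ψ₂ p n).map fun b => Nat.pair a b, ?_, ?_⟩
    · exact Partrec.bind h₁ (Partrec.map (h₂.comp
        (Computable.fst.comp Computable.fst) (Computable.snd.comp Computable.fst))
        (Primrec₂.natPair.to_comp.comp (Computable.snd.comp Computable.fst) Computable.snd))
    · intro p f hf n
      simp [Seq.seq, e₁ p f hf, e₂ p f hf]
  | comp _ _ ih₁ ih₂ =>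
    obtain ⟨ψ₁, h₁, e₁⟩ := ih₁
    obtain ⟨ψ₂, h₂, e₂⟩ := ih₂
    refine ⟨fun p n => (ψ₂ p n).bind fun a => ψ₁ p a, ?_, ?_⟩
    · exact Partrec.bind h₂ (h₁.comp (Computable.fst.comp Computable.fst) Computable.snd)
    · intro p f hf n
      simp only [e₁ p f hf, e₂ p f hf]
      rfl
  | prec _ _ ih₁ ih₂ =>
    obtain ⟨ψ₁, h₁, e₁⟩ := ih₁
    obtain ⟨ψ₂, h₂, e₂⟩ := ih₂
    refine ⟨fun p n => (n.unpair.2).rec (ψ₁ p n.unpair.1) fun y IH =>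
      IH.bind fun i => ψ₂ p (Nat.pair n.unpair.1 (Nat.pair y i)), ?_, ?_⟩
    · have hu : Computable fun q : P × ℕ => q.2.unpair := Computable.unpair.comp Computable.snd
      have hψ : Partrec₂ fun (q : P × ℕ) (z : ℕ × ℕ) =>
          ψ₂ q.1 (Nat.pair q.2.unpair.1 (Nat.pair z.1 z.2)) := by
        refine Partrec₂.comp h₂ (Computable.fst.comp Computable.fst) ?_
        exact Primrec₂.natPair.to_comp.comp (Computable.fst.comp (hu.comp Computable.fst))
          (Primrec₂.natPair.to_comp.comp (Computable.fst.comp Computable.snd)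
            (Computable.snd.comp Computable.snd))
      exact Partrec.nat_rec (Computable.snd.comp hu)
        (Partrec₂.comp h₁ Computable.fst (Computable.fst.comp hu)) hψ
    · intro p f hf n
      dsimp only
      generalize n.unpair.2 = y
      induction y with
      | zero => exact e₁ p f hf _
      | succ y ih =>
        dsimp only at ih ⊢
        rw [ih]
        have : ψ₂ p = _ := funext (e₂ p f hf)
        rw [this]
        rfl
  | rfind _ ih =>
    obtain ⟨ψ, h₁, e₁⟩ := ih
    refine ⟨fun p a => Nat.rfind fun n => (ψ p (Nat.pair a n)).map fun m => decide (m = 0), ?_, ?_⟩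
    · refine Partrec.rfind (Partrec.map (h₁.comp (Computable.fst.comp Computable.fst)
        (Primrec₂.natPair.to_comp.comp (Computable.snd.comp Computable.fst) Computable.snd)) ?_)
      exact (Primrec.eq.decide.comp Primrec.snd (Primrec.const 0)).to_comp
    · intro p f hf n
      simp only [e₁ p f hf]
      rfl

end TuringFunctional

/-! ### Programs and Kolmogorov complexity -/

/-- The program `1^c 0 v`, which runs the machine `φ_c` on the word `v`. -/
def programOf (c : ℕ) (v : List Bool) : List Bool :=
  List.replicate c true ++ false :: v

theorem length_programOf (c : ℕ) (v : List Bool) : (programOf c v).length = c + 1 + v.length := by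
  simp [programOf]; omega

theorem splitProgram_programOf (c : ℕ) (v : List Bool) :
    splitProgram (programOf c v) = (c, v) := by
  induction c with
  | zero => rfl
  | succ c ih =>
    have : programOf (c + 1) v = true :: programOf c v := by simp [programOf, List.replicate_succ]
    rw [this, splitProgram, ih]

theorem primrec_splitProgram : Primrec splitProgram := by
  have h : Primrec₂ fun (_ : List Bool) (p : Bool × List Bool × (ℕ × List Bool)) =>
      bif p.1 then (p.2.2.1 + 1, p.2.2.2) else (0, p.2.1) :=
    Primrec.cond (Primrec.fst.comp Primrec.snd)
      ((Primrec.succ.comp (Primrec.fst.comp (Primrec.snd.comp (Primrec.snd.comp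
        Primrec.snd)))).pair (Primrec.snd.comp (Primrec.snd.comp (Primrec.snd.comp Primrec.snd))))
      ((Primrec.const 0).pair (Primrec.fst.comp (Primrec.snd.comp Primrec.snd)))
  refine (Primrec.list_rec Primrec.id (Primrec.const (0, ([] : List Bool))) h).of_eq fun w => ?_
  induction w with
  | nil => rfl
  | cons b w ih => cases b <;> simp_all [splitProgram]

theorem partrec_phi : Partrec₂ phi :=
  Nat.Partrec.Code.eval_part.comp
    ((Computable.ofNat Nat.Partrec.Code).comp Computable.fst) Computable.snd

theorem partrec_universal : Partrec₂ universal := by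
  have h : Computable fun p : List Bool × ℕ => splitProgram p.1 :=
    primrec_splitProgram.to_comp.comp Computable.fst
  exact partrec_phi.comp (Computable.fst.comp h) (Primrec₂.natPair.to_comp.comp
    (Computable.encode.comp (Computable.snd.comp h)) Computable.snd)

/-- A partial recursive function with parameters has an index that is computable in the
parameters. -/
theorem exists_index {P : Type*} [Primcodable P] {ψ : P → ℕ →. ℕ} (hψ : Partrec₂ ψ) :
    ∃ s : P → ℕ, Primrec s ∧ ∀ p n, phi (s p) n = ψ p n := by
  have hd : Partrec fun x : ℕ => (Part.ofOption (Encodable.decode (α := P) x.unpair.1)).bind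
      fun p => ψ p x.unpair.2 := by
    refine Partrec.bind (Computable.ofOption (Computable.decode.comp
      (Computable.fst.comp Computable.unpair))) ?_
    exact hψ.comp Computable.snd (Computable.snd.comp (Computable.unpair.comp Computable.fst))
  obtain ⟨c, hc⟩ := Nat.Partrec.Code.exists_code.1 (Partrec.nat_iff.1 hd)
  refine ⟨fun p => Encodable.encode (c.curry (Encodable.encode p)),
    Primrec.encode.comp (Nat.Partrec.Code.primrec₂_curry.comp (Primrec.const c) Primrec.encode),
    fun p n => ?_⟩
  simp [phi, Nat.Partrec.Code.eval_curry, hc]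

/-- Every machine that reads a word is run by the universal machine. -/
theorem exists_machine {ψ : List Bool → ℕ →. ℕ} (hψ : Partrec₂ ψ) :
    ∃ c, ∀ v n, universal (programOf c v) n = ψ v n := by
  have hd : Partrec₂ fun (_ : Unit) (x : ℕ) => 
      ψ ((Encodable.decode (α := List Bool) x.unpair.1).getD []) x.unpair.2 := by
    have hu : Computable fun p : Unit × ℕ => p.2.unpair := Computable.unpair.comp Computable.snd
    exact hψ.comp (Computable.option_getD (Computable.decode.comp (Computable.fst.comp hu))
        (Computable.const []))
      (Computable.snd.comp hu)
  obtain ⟨s, -, hs⟩ := exists_index hd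
  exact ⟨s (), fun v n => by simp [universal, splitProgram_programOf, hs]⟩

section

variable {X Y : Type*} {δ : Naming X} {γ : Naming Y}

theorem complexity_le_iff {x : X} {k : ℕ} :
    complexity δ x ≤ k ↔ ∃ w, ProgramFor δ w x ∧ w.length ≤ k := by
  constructor
  · intro h
    by_contra! hcon
    have : ((k + 1 : ℕ) : ℕ∞) ≤ complexity δ x :=
      le_iInf₂ fun w hw => by exact_mod_cast hcon w hw
    have := this.trans h
    norm_cast at this
    omega
  · rintro ⟨w, hw, hk⟩
    exact (iInf₂_le w hw).trans (by exact_mod_cast hk)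

theorem ComputablePoint.exists_complexity_le (x : ComputablePoint δ) :
    ∃ k : ℕ, complexity δ x.1 ≤ k := by
  obtain ⟨f, hf, hx⟩ := x.2
  obtain ⟨c, hc⟩ := exists_machine (ψ := fun _ n => Part.some (f n)) (hf.comp Computable.snd).partrec
  exact ⟨_, complexity_le_iff.2 ⟨programOf c [], ⟨f, fun n => by simp [hc], hx⟩, le_rfl⟩⟩

/-- The tape `k, f 0, f 1, …`. -/
def prefixed (k : ℕ) (f : Baire) : Baire := fun n => Nat.casesOn n k f

theorem kName_prefixed {k : ℕ} {f : Baire} {x : X} :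
    KName δ (prefixed k f) x ↔ complexity δ x ≤ k ∧ δ f x := Iff.rfl

theorem partrec_prefixed {P : Type*} [Primcodable P] {b : P → ℕ} {H : P → ℕ →. ℕ}
    (hb : Computable b) (hH : Partrec₂ H) :
    Partrec₂ fun p n => (Nat.casesOn n (Part.some (b p)) (H p) : Part ℕ) := by
  exact Partrec.nat_casesOn_right (h := fun (q : P × ℕ) n => H q.1 n) Computable.snd
    (hb.comp Computable.fst) (hH.comp (Computable.fst.comp Computable.fst) Computable.snd)

/-- A machine that maps the names of `x`, prefixed by a bound for the complexity of `x`, to names of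
`F x` witnesses that `F` is `K`-computable: `K (F x)` exceeds `K x` by at most a constant. -/
theorem kComputable_of_functional {F : ComputablePoint δ → ComputablePoint γ} {Φ : Baire → ℕ →. ℕ}
    (hΦ : TuringFunctional Φ)
    (h : ∀ (f : Baire) (x : ComputablePoint δ), KName δ f x.1 →
      ∃ g : Baire, (∀ n, g n ∈ Φ f n) ∧ γ g (F x).1) :
    KComputable δ γ F := by
  obtain ⟨ψ, hψ, e⟩ := hΦ.exists_partrec
    (partrec_prefixed (Primrec.list_length (α := Bool)).to_comp partrec_universal)
  obtain ⟨c, hc⟩ := exists_machine hψ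
  have hb : TuringFunctional fun f _ => Part.some (f 0 + (c + 1)) :=
    TuringFunctional.map_some (h := fun n => n + (c + 1))
      (Primrec.nat_add.comp Primrec.id (Primrec.const (c + 1))).to_comp
      (TuringFunctional.read (a := fun _ => 0) (Computable.const 0))
  obtain ⟨Ψ, hΨ, hcons⟩ := hΦ.cons hb
  refine ⟨Ψ, hΨ, fun f x hf => ?_⟩
  obtain ⟨g, hg, hgx⟩ := h f x hf
  refine ⟨prefixed (f 0 + (c + 1)) g, hcons f g hg, kName_prefixed.2 ⟨?_, hgx⟩⟩
  obtain ⟨w, ⟨f', hf', hx'⟩, hw⟩ := complexity_le_iff.1 hf.1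
  obtain ⟨g', hg', hgx'⟩ := h (prefixed w.length f') x
    (kName_prefixed.2 ⟨complexity_le_iff.2 ⟨w, ⟨f', hf', hx'⟩, le_rfl⟩, hx'⟩)
  refine complexity_le_iff.2 ⟨programOf c w, ⟨g', fun n => ?_, hgx'⟩, ?_⟩
  · rw [hc, e w (prefixed w.length f')]
    · exact hg' n
    · rintro (_ | n)
      · exact Part.mem_some _
      · exact hf' n
  · rw [length_programOf]; omega

theorem Type2Computable.kComputable {F : ComputablePoint δ → ComputablePoint γ}
    (h : Type2Computable δ γ F) : KComputable δ γ F := by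
  obtain ⟨Φ, hΦ, hF⟩ := h
  exact kComputable_of_functional hΦ.tail fun f x hf => hF _ x hf.2

theorem KComputable.markovComputable {F : ComputablePoint δ → ComputablePoint γ}
    (h : KComputable δ γ F) : MarkovComputable δ γ F := by
  obtain ⟨Φ, hΦ, hF⟩ := h
  -- `φ_(b e)` ignores its word and otherwise agrees with `φ_e`, so the program `1^(b e) 0`, of
  -- length `b e + 1`, computes what `φ_e` computes
  have hb' : Partrec₂ fun (e n : ℕ) => phi e n.unpair.2 :=
    partrec_phi.comp Computable.fst (Computable.snd.comp (Computable.unpair.comp Computable.snd))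
  obtain ⟨b, hb, eb⟩ := exists_index hb'
  have hb₁ : Computable fun e => b e + 1 := Computable.succ.comp hb.to_comp
  obtain ⟨ψ, hψ, e⟩ := hΦ.exists_partrec (partrec_prefixed hb₁ partrec_phi)
  have hψ' : Partrec₂ fun p n => ψ p (n + 1) :=
    hψ.comp Computable.fst (Computable.succ.comp Computable.snd)
  obtain ⟨s, hs, es⟩ := exists_index hψ'
  refine ⟨fun i => Part.some (s i), Partrec.nat_iff.1 hs.to_comp.partrec, fun i x hx => ?_⟩
  obtain ⟨f, hf, hfx⟩ := hx
  have hK : complexity δ x.1 ≤ (b i + 1 : ℕ) := by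
    refine complexity_le_iff.2 ⟨programOf (b i) [], ⟨f, fun n => ?_, hfx⟩, ?_⟩
    · simpa [universal, splitProgram_programOf, eb] using hf n
    · simp [length_programOf]
  obtain ⟨g, hg, -, hgx⟩ := hF (prefixed (b i + 1) f) x (kName_prefixed.2 ⟨hK, hfx⟩)
  refine ⟨s i, Part.mem_some _, fun n => g (n + 1), fun n => ?_, hgx⟩
  rw [es, e i (prefixed (b i + 1) f)]
  · exact hg (n + 1)
  · rintro (_ | n)
    · exact Part.mem_some _
    · exact hf n

end

/-! ### Initial segments in enumerations -/

/-- The length of the initial segment of `ℕ` that the `i`-th finite list spells out, and `0` if that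
list is not of the form `0, 1, …, n - 1`. -/
def segment (i : ℕ) : ℕ :=
  if Denumerable.ofNat (List ℕ) i = List.range (Denumerable.ofNat (List ℕ) i).length then
    (Denumerable.ofNat (List ℕ) i).length
  else 0

theorem primrec_segment : Primrec segment := by
  have h : Primrec fun i : ℕ => Denumerable.ofNat (List ℕ) i := Primrec.ofNat _
  have hl := Primrec.list_length.comp h
  exact Primrec.ite (Primrec.eq.comp h (Primrec.list_range.comp hl)) hl (Primrec.const 0)

theorem exists_le_segment_iff {f : Baire} {A : Set ℕ} (hf : powerNaming f A) {n : ℕ} :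
    (∃ t, n ≤ segment (f t)) ↔ ∀ i < n, i ∈ A := by
  constructor
  · rintro ⟨t, ht⟩ i hi
    have hA : f t ∈ {i | A ∈ scottBasis i} := hf ▸ Set.mem_range_self t
    refine hA i ?_
    unfold segment at ht
    split_ifs at ht with h
    · rw [h]; exact List.mem_range.2 (hi.trans_le ht)
    · omega
  · intro h
    have hA : Encodable.encode (List.range n) ∈ Set.range f := by
      rw [show Set.range f = _ from hf]
      intro i hi
      rw [Denumerable.ofNat_encode] at hi
      exact h i (List.mem_range.1 hi)
    obtain ⟨t, ht⟩ := hA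
    exact ⟨t, by simp [segment, ht]⟩

theorem segment_zero : segment 0 = 0 := by
  have : Denumerable.ofNat (List ℕ) 0 = [] := Denumerable.ofNat_encode (α := List ℕ) []
  simp [segment, this]

/-- The length of the longest initial segment that has been seen after `s` steps in the sequence
computed by `φ_e`. Step `⟨t, n⟩` runs the computation of the `n`-th entry for `t` steps. -/
def position (e : ℕ) : ℕ → ℕ
  | 0 => 0
  | s + 1 => max (position e s) (segment
      ((Nat.Partrec.Code.evaln s.unpair.1 (Denumerable.ofNat _ e) s.unpair.2).getD 0))

theorem position_mono (e : ℕ) : Monotone (position e) :=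
  monotone_nat_of_le_succ fun _ => le_max_left _ _

theorem primrec_position : Primrec₂ position := by
  have hs : Primrec fun q : ℕ × ℕ × ℕ => q.2.1.unpair :=
    Primrec.unpair.comp (Primrec.fst.comp Primrec.snd)
  have h : Primrec₂ fun (e : ℕ) (p : ℕ × ℕ) => max p.2 (segment
      ((Nat.Partrec.Code.evaln p.1.unpair.1 (Denumerable.ofNat _ e) p.1.unpair.2).getD 0)) :=
    Primrec.nat_max.comp (Primrec.snd.comp Primrec.snd) (primrec_segment.comp
      (Primrec.option_getD.comp (Nat.Partrec.Code.primrec_evaln.comp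
        (((Primrec.fst.comp hs).pair ((Primrec.ofNat _).comp Primrec.fst)).pair
          (Primrec.snd.comp hs))) (Primrec.const 0)))
  refine (Primrec.nat_rec (Primrec.const 0) h).of_eq fun e s => ?_
  induction s with
  | zero => rfl
  | succ s ih => simp only [position, ← ih]

theorem exists_le_position_iff {e : ℕ} {A : Set ℕ} (h : MarkovName powerNaming e A) {n : ℕ} :
    (∃ s, n ≤ position e s) ↔ ∀ i < n, i ∈ A := by
  obtain ⟨f, hf, hA⟩ := h
  rw [← exists_le_segment_iff hA]
  constructor
  · rintro ⟨s, hs⟩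
    induction s with
    | zero => exact ⟨0, hs.trans (Nat.zero_le _)⟩
    | succ s ih =>
      rcases le_max_iff.1 hs with h | h
      · exact ih h
      · rcases ho : Nat.Partrec.Code.evaln s.unpair.1 (Denumerable.ofNat _ e) s.unpair.2 with _ | v
        · simp only [ho, Option.getD_none, segment_zero] at h
          exact ⟨0, h.trans (Nat.zero_le _)⟩
        · have hv : v ∈ phi e s.unpair.2 := Nat.Partrec.Code.evaln_sound ho
          obtain rfl := Part.mem_unique hv (hf _)
          exact ⟨_, by simpa [ho] using h⟩
  · rintro ⟨t, ht⟩
    obtain ⟨k, hk⟩ := Nat.Partrec.Code.evaln_complete.1 (hf t)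
    have hk' := Option.mem_def.1 hk
    exact ⟨Nat.pair k t + 1, le_max_of_le_right (by simpa [hk'] using ht)⟩

/-- A name of the initial segment `{0, …, m - 1}`; as `m` grows, it converges to the name of `ℕ` that
enumerates every index. -/
def segmentName (m : ℕ) : Baire := fun i =>
  if ∀ n ∈ Denumerable.ofNat (List ℕ) i, n < m then i else 0

theorem primrec_segmentName : Primrec₂ segmentName := by
  have h : PrimrecPred fun q : ℕ × ℕ => ∀ n ∈ Denumerable.ofNat (List ℕ) q.2, n < q.1 :=
    Primrec.nat_lt.forall_mem_list.comp ((Primrec.ofNat _).comp Primrec.snd) Primrec.fst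
  exact Primrec.ite h Primrec.snd (Primrec.const 0)

theorem powerNaming_segmentName (m : ℕ) : powerNaming (segmentName m) (Set.Iio m) := by
  have h0 : Denumerable.ofNat (List ℕ) 0 = [] := Denumerable.ofNat_encode (α := List ℕ) []
  ext i
  constructor
  · rintro ⟨t, rfl⟩ n hn
    unfold segmentName at hn
    split_ifs at hn with h
    · exact h n hn
    · simp [h0] at hn
  · exact fun h => ⟨i, if_pos h⟩

theorem powerNaming_id : powerNaming id Set.univ := by
  ext i; simp [scottBasis]

theorem exists_segmentName_eq (N : ℕ) : ∃ m₀, ∀ m ≥ m₀, ∀ i < N, segmentName m i = i := by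
  refine ⟨(Finset.range N).sup fun i => (Denumerable.ofNat (List ℕ) i).sum + 1,
    fun m hm i hi => if_pos fun n hn => ?_⟩
  have h₁ : n ≤ (Denumerable.ofNat (List ℕ) i).sum := List.le_sum_of_mem hn
  have h₂ := Finset.le_sup (f := fun i => (Denumerable.ofNat (List ℕ) i).sum + 1)
    (Finset.mem_range.2 hi)
  omega

/-! ### Listing cylinders -/

theorem getD_of_mem_cylinder {u : List ℕ} {g : Baire} (h : g ∈ cylinder u) {i : ℕ}
    (hi : i < u.length) : u.getD i 0 = g i := by
  rw [mem_cylinder_iff.1 h i hi, List.getD_eq_getElem _ _ hi]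

theorem mem_cylinder_prefix (g : Baire) (n : ℕ) : g ∈ cylinder ((List.range n).map g) := by
  simp [cylinder]

/-- An open set given by a decidable condition on finite prefixes can be listed, uniformly in
parameters. -/
theorem exists_listing {P β : Type*} [Primcodable P] [Primcodable β] {R : P → Baire → β → Prop}
    {b : P → β → ℕ} (hb : Primrec₂ b)
    (hR : PrimrecPred fun q : P × List ℕ × β => R q.1 (fun i => q.2.1.getD i 0) q.2.2)
    (hloc : ∀ p y g g', (∀ i < b p y, g i = g' i) → R p g y → R p g' y) :
    ∃ l : P → Baire, Primrec₂ l ∧ ∀ p g,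
      (∃ n u, l p n = Encodable.encode u + 1 ∧ g ∈ cylinder u) ↔ ∃ y, R p g y := by
  classical
  have hC : PrimrecPred fun q : P × List ℕ × β =>
      b q.1 q.2.2 ≤ q.2.1.length ∧ R q.1 (fun i => q.2.1.getD i 0) q.2.2 :=
    (Primrec.nat_le.comp (hb.comp Primrec.fst (Primrec.snd.comp Primrec.snd))
      (Primrec.list_length.comp (Primrec.fst.comp Primrec.snd))).and hR
  let l : P → Baire := fun p n => Option.casesOn (Encodable.decode (α := List ℕ × β) n) 0 fun z =>
    if b p z.2 ≤ z.1.length ∧ R p (fun i => z.1.getD i 0) z.2 then Encodable.encode z.1 + 1 else 0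
  refine ⟨l, ?_, fun p g => ⟨?_, ?_⟩⟩
  · refine Primrec.option_casesOn (Primrec.decode.comp Primrec.snd) (Primrec.const 0) ?_
    exact Primrec.ite (hC.comp ((Primrec.fst.comp Primrec.fst).pair Primrec.snd))
      (Primrec.succ.comp (Primrec.encode.comp (Primrec.fst.comp Primrec.snd))) (Primrec.const 0)
  · rintro ⟨n, u, hn, hg⟩
    simp only [l] at hn
    rcases hz : Encodable.decode (α := List ℕ × β) n with _ | ⟨u', y⟩
    · simp [hz] at hn
    · simp only [hz] at hn
      split_ifs at hn with hc
      obtain rfl : u' = u := Encodable.encode_injective (Nat.succ_injective hn)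
      exact ⟨y, hloc p y _ g (fun i hi => getD_of_mem_cylinder hg (hi.trans_le hc.1)) hc.2⟩
  · rintro ⟨y, hy⟩
    have hg := mem_cylinder_prefix g (b p y)
    refine ⟨Encodable.encode ((List.range (b p y)).map g, y), _, ?_, hg⟩
    simp only [l, Encodable.encodek]
    refine if_pos ⟨by simp, hloc p y g _ (fun i hi => ?_) hy⟩
    exact (getD_of_mem_cylinder hg (by simpa using hi)).symm

/-- A family of sets `S x`, each a union of computably listed cylinders, as a function into the
computable open sets. -/
def toOpens {X : Type*} (S : X → Set Baire)
    (h : ∀ x, ∃ f : Baire, Computable f ∧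
      ∀ g, (∃ n u, f n = Encodable.encode u + 1 ∧ g ∈ cylinder u) ↔ g ∈ S x) :
    X → ComputablePoint openNaming := fun x =>
  ⟨⟨S x, by
    obtain ⟨f, -, hf⟩ := h x
    have : S x = ⋃ (n : ℕ) (u : List ℕ) (_ : f n = Encodable.encode u + 1), cylinder u := by
      ext g; simp only [← hf, Set.mem_iUnion, exists_prop]
    rw [this]
    exact isOpen_iUnion fun n => isOpen_iUnion fun u => isOpen_iUnion fun _ =>
      (isClopen_cylinder u).isOpen⟩,
    let ⟨f, hf, hS⟩ := h x
    ⟨f, hf, fun g => (hS g).symm⟩⟩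

/-! ### Open sets decided by approximations to initial segments -/

section Outgrows

variable {ι : Type*} {ρ : ι → ℕ → ℕ}

/-- `G` outgrows the approximations: at every place `x`, for the indices `e ∈ I x`, the value `G x`
bounds `ρ e` if `ρ e` is bounded, and waiting until stage `G x` is enough to see `ρ e` leave the value
that it has at stage `x`, if it ever does. -/
def Outgrows (I : ℕ → Set ι) (ρ : ι → ℕ → ℕ) (G : Baire) : Prop :=
  ∀ x, ∀ e ∈ I x, ((∃ B, ∀ s, ρ e s ≤ B) → ∀ s, ρ e s ≤ G x) ∧
    ((∃ s, ρ e x < ρ e s) → ρ e x < ρ e (G x))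

theorem exists_outgrows (hρ : ∀ e, Monotone (ρ e)) {I : ℕ → Set ι} (hI : ∀ x, (I x).Finite) :
    ∃ G, Outgrows I ρ G := by
  have key : ∀ x (e : ι), ∃ b, ∀ c ≥ b, ((∃ B, ∀ s, ρ e s ≤ B) → ∀ s, ρ e s ≤ c) ∧
      ((∃ s, ρ e x < ρ e s) → ρ e x < ρ e c) := by
    intro x e
    have h₁ : ∃ b₁, (∃ B, ∀ s, ρ e s ≤ B) → ∀ s, ρ e s ≤ b₁ := by
      by_cases h : ∃ B, ∀ s, ρ e s ≤ B
      · exact ⟨h.choose, fun _ => h.choose_spec⟩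
      · exact ⟨0, fun h' => absurd h' h⟩
    have h₂ : ∃ b₂, (∃ s, ρ e x < ρ e s) → ρ e x < ρ e b₂ := by
      by_cases h : ∃ s, ρ e x < ρ e s
      · exact ⟨h.choose, fun _ => h.choose_spec⟩
      · exact ⟨0, fun h' => absurd h' h⟩
    obtain ⟨b₁, h₁⟩ := h₁
    obtain ⟨b₂, h₂⟩ := h₂
    exact ⟨max b₁ b₂, fun c hc => ⟨fun h s => (h₁ h s).trans ((le_max_left _ _).trans hc),
      fun h => (h₂ h).trans_le (hρ e ((le_max_right _ _).trans hc))⟩⟩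
  choose b hb using key
  refine ⟨fun x => (hI x).toFinset.sup (b x), fun x e he => hb x e _ ?_⟩
  exact Finset.le_sup ((hI x).mem_toFinset.2 he)

/-- If approximations have rested from stage `x` for as long as an outgrowing sequence prescribes,
then they rest forever. -/
theorem Outgrows.le_of_rest {I : ℕ → Set ι} {G : Baire} (hG : Outgrows I ρ G)
    (hρ : ∀ e, Monotone (ρ e)) {x s : ℕ} {e : ι} (he : e ∈ I x) (hs : G x ≤ s)
    (h : ρ e s = ρ e x) (t : ℕ) : ρ e t ≤ ρ e x := by
  by_contra! hlt
  exact absurd (((hG x e he).2 ⟨t, hlt⟩).trans_le (hρ e hs)) (by simp [h])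

end Outgrows

section Target

variable {ι : Type*} [Primcodable ι]

/-- The approximations `ρ e 0 ≤ ρ e 1 ≤ …` accept `g` at stage `s` with witness `j`: they exceed `g j`,
where the place `j` is subject to the condition `P`, which may consult the entry of `g` at `e`. -/
def Accepts (P : ι → ℕ → ℕ → Prop) (ρ : ι → ℕ → ℕ) (g : Baire) (e : ι) (j s : ℕ) : Prop :=
  P e j (g (Encodable.encode e)) ∧ j ≤ s ∧ g j < ρ e s

/-- For `y = (e, j, s, s')`: the approximations `ρ e` accept `g` at stage `s`, and then rest at a
value `≤ m` until stage `s'`, which is at least as large as the waiting time `g s`. -/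
def Settles (P : ι → ℕ → ℕ → Prop) (ρ : ι → ℕ → ℕ) (m : ℕ) (g : Baire) (y : ι × ℕ × ℕ × ℕ) : Prop :=
  Accepts P ρ g y.1 y.2.1 y.2.2.1 ∧ g y.2.2.1 ≤ y.2.2.2 ∧ y.2.2.1 ≤ y.2.2.2 ∧
    ρ y.1 y.2.2.2 = ρ y.1 y.2.2.1 ∧ ρ y.1 y.2.2.2 ≤ m

/-- The set of sequences attached to `A`: everything if `A = ℕ`, and otherwise the sequences that
settle below the least number missing from `A`. -/
def target (P : ι → ℕ → ℕ → Prop) (ρ : ι → ℕ → ℕ) (A : Set ℕ) : Set Baire :=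
  {g | A = Set.univ ∨ ∃ m, (∀ i < m, i ∈ A) ∧ ∃ y, Settles P ρ m g y}

variable {P : ι → ℕ → ℕ → Prop} {ρ : ι → ℕ → ℕ}

theorem Accepts.congr {g g' : Baire} {e : ι} {j s : ℕ}
    (h : ∀ i < max (Encodable.encode e) s + 1, g i = g' i) (hg : Accepts P ρ g e j s) :
    Accepts P ρ g' e j s := by
  obtain ⟨h₁, h₂, h₃⟩ := hg
  exact ⟨h _ (Nat.lt_succ_of_le (le_max_left _ _)) ▸ h₁, h₂,
    h j (Nat.lt_succ_of_le (h₂.trans (le_max_right _ _))) ▸ h₃⟩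

theorem Settles.congr {m : ℕ} {g g' : Baire} {y : ι × ℕ × ℕ × ℕ}
    (h : ∀ i < max (Encodable.encode y.1) y.2.2.1 + 1, g i = g' i) (hg : Settles P ρ m g y) :
    Settles P ρ m g' y :=
  ⟨hg.1.congr h, h _ (Nat.lt_succ_of_le (le_max_right _ _)) ▸ hg.2.1, hg.2.2⟩

theorem Settles.mono {m m' : ℕ} (hm : m ≤ m') {g : Baire} {y : ι × ℕ × ℕ × ℕ}
    (h : Settles P ρ m g y) : Settles P ρ m' g y :=
  ⟨h.1, h.2.1, h.2.2.1, h.2.2.2.1, h.2.2.2.2.trans hm⟩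

theorem mem_target_Iio {m : ℕ} {g : Baire} (h : g ∈ target P ρ (Set.Iio m)) :
    ∃ y, Settles P ρ m g y := by
  rcases h with h | ⟨m', hm', y, hy⟩
  · exact absurd (h ▸ Set.mem_univ m : m ∈ Set.Iio m) (lt_irrefl m)
  · refine ⟨y, hy.mono (not_lt.1 fun hlt => lt_irrefl m (hm' m hlt))⟩

/-- What the approximations to `A` itself accept is in the set attached to `A`: if `A ≠ ℕ`, they come
to rest. -/
theorem mem_target_of_accepts (hρ : ∀ e, Monotone (ρ e)) {A : Set ℕ} {e : ι}
    (hA : ∀ n, (∃ s, n ≤ ρ e s) ↔ ∀ i < n, i ∈ A) {g : Baire} {j s : ℕ}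
    (h : Accepts P ρ g e j s) : g ∈ target P ρ A := by
  classical
  by_cases hu : A = Set.univ
  · exact Or.inl hu
  · have hex : ∃ m, m ∉ A := by simpa [Set.eq_univ_iff_forall] using hu
    have hm : ∀ i < Nat.find hex, i ∈ A := fun i hi => not_not.1 (Nat.find_min hex hi)
    have hle : ∀ t, ρ e t ≤ Nat.find hex := fun t => not_lt.1 fun hlt =>
      Nat.find_spec hex ((hA _).1 ⟨t, le_rfl⟩ _ hlt)
    obtain ⟨t, ht⟩ := (hA _).2 hm
    have heq : ∀ x ≥ t, ρ e x = Nat.find hex := fun x hx =>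
      le_antisymm (hle x) (ht.trans (hρ e hx))
    refine Or.inr ⟨Nat.find hex, hm, (e, j, max s t, max (max s t) (g (max s t))),
      ⟨h.1, h.2.1.trans (le_max_left _ _), h.2.2.trans_le (hρ e (le_max_left _ _))⟩,
      le_max_right _ _, le_max_left _ _, ?_, hle _⟩
    exact (heq _ ((le_max_right s t).trans (le_max_left _ _))).trans
      (heq _ (le_max_right s t)).symm

theorem primrecPred_accepts (hP : PrimrecPred fun q : ι × ℕ × ℕ => P q.1 q.2.1 q.2.2)
    (hρ : Primrec₂ ρ) {α : Type*} [Primcodable α] {u : α → List ℕ} {e : α → ι} {j s : α → ℕ}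
    (hu : Primrec u) (he : Primrec e) (hj : Primrec j) (hs : Primrec s) :
    PrimrecPred fun a => Accepts P ρ (fun i => (u a).getD i 0) (e a) (j a) (s a) :=
  (hP.comp (he.pair (hj.pair ((Primrec.list_getD 0).comp hu (Primrec.encode.comp he))))).and
    ((Primrec.nat_le.comp hj hs).and
      (Primrec.nat_lt.comp ((Primrec.list_getD 0).comp hu hj) (hρ.comp he hs)))

theorem primrecPred_settles (hP : PrimrecPred fun q : ι × ℕ × ℕ => P q.1 q.2.1 q.2.2)
    (hρ : Primrec₂ ρ) {α : Type*} [Primcodable α] {m : α → ℕ} {u : α → List ℕ}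
    {y : α → ι × ℕ × ℕ × ℕ} (hm : Primrec m) (hu : Primrec u) (hy : Primrec y) :
    PrimrecPred fun a => Settles P ρ (m a) (fun i => (u a).getD i 0) (y a) := by
  have he := Primrec.fst.comp hy
  have hj := Primrec.fst.comp (Primrec.snd.comp hy)
  have hs := Primrec.fst.comp (Primrec.snd.comp (Primrec.snd.comp hy))
  have hs' := Primrec.snd.comp (Primrec.snd.comp (Primrec.snd.comp hy))
  exact (primrecPred_accepts hP hρ hu he hj hs).and
    ((Primrec.nat_le.comp ((Primrec.list_getD 0).comp hu hs) hs').and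
    ((Primrec.nat_le.comp hs hs').and
    ((Primrec.eq.comp (hρ.comp he hs') (hρ.comp he hs)).and
      (Primrec.nat_le.comp (hρ.comp he hs') hm))))

/-- An outgrowing sequence never settles, because approximations that have come to rest do not
exceed it. -/
theorem Outgrows.not_settles {I : ℕ → Set ι} (hImono : Monotone I) {G : Baire}
    (hG : Outgrows I ρ G) (hρ : ∀ e, Monotone (ρ e)) (hP : ∀ e j v, P e j v → e ∈ I j)
    (m : ℕ) (y : ι × ℕ × ℕ × ℕ) : ¬ Settles P ρ m G y := by
  obtain ⟨e, j, s, s'⟩ := y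
  rintro ⟨⟨h₁, h₂, h₃⟩, h₄, -, h₆, -⟩
  have he := hP _ _ _ h₁
  have hb := hG.le_of_rest hρ (hImono h₂ he) h₄ h₆
  exact absurd ((hG j e he).1 ⟨_, hb⟩ s) (not_le.2 h₃)

end Target

/-! ### A K-computable function that is not Type-2 computable -/

/-- What a machine writes on the name `id` of `ℕ`, it writes on the names of all large initial
segments. -/
theorem TuringFunctional.exists_mem_segmentName {Φ : Baire → ℕ →. ℕ} (hΦ : TuringFunctional Φ)
    {n v : ℕ} (h : v ∈ Φ id n) : ∃ m₀, ∀ m ≥ m₀, v ∈ Φ (segmentName m) n := by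
  obtain ⟨N, hN⟩ := hΦ.exists_use h
  obtain ⟨m₀, hm₀⟩ := exists_segmentName_eq N
  exact ⟨m₀, fun m hm => hN _ (hm₀ m hm)⟩

/-- The computable point `{0, …, m - 1}` of `P(ℕ)`. -/
def initialSegment (m : ℕ) : ComputablePoint powerNaming :=
  ⟨Set.Iio m, segmentName m,
    (primrec_segmentName.comp (Primrec.const m) Primrec.id).to_comp, powerNaming_segmentName m⟩

/-- The computable point `ℕ` of `P(ℕ)`. -/
def allNumbers : ComputablePoint powerNaming :=
  ⟨Set.univ, id, Computable.id, powerNaming_id⟩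

theorem exists_kComputable_not_type2Computable :
    ∃ F : ComputablePoint powerNaming → ComputablePoint openNaming,
      KComputable powerNaming openNaming F ∧ ¬ Type2Computable powerNaming openNaming F := by
  obtain ⟨ix, hix, eix⟩ := exists_index partrec_universal
  let ρ : List Bool → ℕ → ℕ := fun w => position (ix w)
  let P : List Bool → ℕ → ℕ → Prop := fun w j _ => w.length ≤ j
  have hρ : ∀ w, Monotone (ρ w) := fun w => position_mono _
  have hρp : Primrec₂ ρ := primrec_position.comp (hix.comp Primrec.fst) Primrec.snd
  have hPp : PrimrecPred fun q : List Bool × ℕ × ℕ => P q.1 q.2.1 q.2.2 :=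
    Primrec.nat_le.comp (Primrec.list_length.comp Primrec.fst) (Primrec.fst.comp Primrec.snd)
  have hA : ∀ {w A}, ProgramFor powerNaming w A → ∀ n, (∃ s, n ≤ ρ w s) ↔ ∀ i < n, i ∈ A := by
    rintro w A ⟨f, hf, hfA⟩ n
    exact exists_le_position_iff ⟨f, fun n => by simpa [eix] using hf n, hfA⟩
  -- besides what settles, the machine lists the `g` for which an initial segment of `A` is longer
  -- than `g k`, where `k` is the given bound for the complexity of `A`
  obtain ⟨l, hl, el⟩ := exists_listing (P := ℕ × ℕ) (β := List Bool × ℕ × ℕ × ℕ)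
    (R := fun q g y => g q.1 < q.2 ∨ Settles P ρ q.2 g y)
    (b := fun q y => max q.1 (max (Encodable.encode y.1) y.2.2.1) + 1)
    (Primrec.succ.comp (Primrec.nat_max.comp (Primrec.fst.comp Primrec.fst)
      (Primrec.nat_max.comp (Primrec.encode.comp (Primrec.fst.comp Primrec.snd))
        (Primrec.fst.comp (Primrec.snd.comp (Primrec.snd.comp Primrec.snd))))))
    ((Primrec.nat_lt.comp ((Primrec.list_getD 0).comp (Primrec.fst.comp Primrec.snd)
      (Primrec.fst.comp Primrec.fst)) (Primrec.snd.comp Primrec.fst)).or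
      (primrecPred_settles hPp hρp (Primrec.snd.comp Primrec.fst) (Primrec.fst.comp Primrec.snd)
        (Primrec.snd.comp Primrec.snd)))
    (by
      rintro q y g g' h (hg | hg)
      · exact Or.inl (h q.1 (Nat.lt_succ_of_le (le_max_left _ _)) ▸ hg)
      · exact Or.inr (hg.congr fun i hi => h i (by omega)))
  let L : Baire → Baire := fun f n => l (f 0, segment (f (n.unpair.1 + 1))) n.unpair.2
  have hL : ∀ (f : Baire) (A : Set ℕ), KName powerNaming f A → ∀ g,
      (∃ n u, L f n = Encodable.encode u + 1 ∧ g ∈ cylinder u) ↔ g ∈ target P ρ A := by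
    rintro f A ⟨hk, hf⟩ g
    have hsplit : (∃ n u, L f n = Encodable.encode u + 1 ∧ g ∈ cylinder u) ↔
        ∃ t y, g (f 0) < segment (f (t + 1)) ∨ Settles P ρ (segment (f (t + 1))) g y := by
      constructor
      · rintro ⟨n, u, h⟩
        exact ⟨_, (el _ g).1 ⟨n.unpair.2, u, h⟩⟩
      · rintro ⟨t, h⟩
        obtain ⟨n, u, h⟩ := (el (f 0, segment (f (t + 1))) g).2 h
        exact ⟨Nat.pair t n, u, by simpa [L] using h⟩
    rw [hsplit]
    obtain ⟨w, hw, hwk⟩ := complexity_le_iff.1 hk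
    constructor
    · rintro ⟨t, y, h | h⟩
      · have hseg := (exists_le_segment_iff hf).1 ⟨t, le_rfl⟩
        obtain ⟨s, hs⟩ := (hA hw _).2 hseg
        exact mem_target_of_accepts hρ (hA hw) (e := w) (j := f 0) (s := max (f 0) s)
          ⟨hwk, le_max_left _ _, h.trans_le (hs.trans (hρ w (le_max_right _ _)))⟩
      · exact Or.inr ⟨_, (exists_le_segment_iff hf).1 ⟨t, le_rfl⟩, y, h⟩
    · rintro (rfl | ⟨m, hm, y, hy⟩)
      · obtain ⟨t, ht⟩ := (exists_le_segment_iff (n := g (f 0) + 1) hf).2 fun _ _ => Set.mem_univ _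
        exact ⟨t, ([], 0, 0, 0), Or.inl ht⟩
      · obtain ⟨t, ht⟩ := (exists_le_segment_iff hf).2 hm
        exact ⟨t, y, Or.inr (hy.mono ht)⟩
  let F := toOpens (fun x : ComputablePoint powerNaming => target P ρ x.1) (by
    intro x
    obtain ⟨f, hf, hx⟩ := x.2
    obtain ⟨k, hk⟩ := x.exists_complexity_le
    refine ⟨L (prefixed k f), ?_, hL _ _ (kName_prefixed.2 ⟨hk, hx⟩)⟩
    refine hl.to_comp.comp ((Computable.const k).pair (primrec_segment.to_comp.comp
      (hf.comp (Computable.fst.comp Computable.unpair)))) (Computable.snd.comp Computable.unpair))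
  refine ⟨F, kComputable_of_functional (Φ := fun f n => Part.some (L f n)) ?_
    fun f x hf => ⟨L f, fun n => Part.mem_some _, fun g => (hL f _ hf g).symm⟩, ?_⟩
  · have hc : Computable fun z : ℕ => l (z.unpair.1.unpair.1, segment z.unpair.1.unpair.2)
        z.unpair.2.unpair.2 := by
      have h₁ : Computable fun z : ℕ => z.unpair.1.unpair :=
        Computable.unpair.comp (Computable.fst.comp Computable.unpair)
      exact hl.to_comp.comp ((Computable.fst.comp h₁).pair
        (primrec_segment.to_comp.comp (Computable.snd.comp h₁)))
        (Computable.snd.comp (Computable.unpair.comp (Computable.snd.comp Computable.unpair)))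
    have := TuringFunctional.map_some hc (((TuringFunctional.read (Computable.const 0)).pair_some
      (.read (Computable.succ.comp (Computable.fst.comp Computable.unpair)))).pair_some
      (.of_computable Computable.id))
    simpa [L] using this
  · rintro ⟨Φ, hΦ, hF⟩
    have hfin : ∀ x, {w : List Bool | w.length ≤ x}.Finite := fun x => List.finite_length_le _ _
    obtain ⟨G, hG⟩ := exists_outgrows (ρ := ρ) hρ hfin
    obtain ⟨g, hg, hgU⟩ := hF id allNumbers powerNaming_id
    obtain ⟨n, u, hn, hu⟩ := (hgU G).1 (Or.inl rfl)
    have hv := hg n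
    rw [hn] at hv
    obtain ⟨m, hm⟩ := hΦ.exists_mem_segmentName hv
    obtain ⟨g', hg', hgU'⟩ := hF _ (initialSegment m) (powerNaming_segmentName m)
    have : G ∈ target P ρ (Set.Iio m) :=
      (hgU' G).2 ⟨n, u, Part.mem_unique (hg' n) (hm m le_rfl), hu⟩
    obtain ⟨y, hy⟩ := mem_target_Iio this
    have hmono : Monotone fun x => {w : List Bool | w.length ≤ x} :=
      fun _ _ h _ h' => le_trans h' h
    exact hG.not_settles hmono hρ (fun _ _ _ h => h) m y hy

/-! ### A Markov computable function that is not K-computable -/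

/-- The condition on the witnesses `j`: the approximations to the `e`-th set exceed the entry
`v` of the sequence at `e` by stage `j`. -/
def Exceeds (e j v : ℕ) : Prop := e ≤ j ∧ v < position e j

theorem primrecPred_exceeds : PrimrecPred fun q : ℕ × ℕ × ℕ => Exceeds q.1 q.2.1 q.2.2 :=
  (Primrec.nat_le.comp Primrec.fst (Primrec.fst.comp Primrec.snd)).and
    (Primrec.nat_lt.comp (Primrec.snd.comp Primrec.snd)
      (primrec_position.comp Primrec.fst (Primrec.fst.comp Primrec.snd)))

/-- By stage `s`, every `e` that exceeds the finite sequence `u` at some `j` is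
known to exceed `m`, and does not rest from stage `j` for the waiting time that `u` prescribes. -/
def Harmless (u : List ℕ) (m s : ℕ) : Prop :=
  ∀ j < u.length, ∀ e < j + 1, u.getD e 0 < position e j →
    m < position e s ∧ position e j < position e (u.getD j 0)

theorem primrecRel_forall_lt {β : Type*} [Primcodable β] {R : ℕ → β → Prop} (hR : PrimrecRel R) :
    PrimrecRel fun n y => ∀ x < n, R x y :=
  (hR.forall_mem_list.comp (Primrec.list_range.comp Primrec.fst) Primrec.snd).of_eq (by simp)

theorem primrecPred_harmless :
    PrimrecPred fun q : List ℕ × ℕ × ℕ => Harmless q.1 q.2.1 q.2.2 := by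
  have h₀ : PrimrecRel fun (e : ℕ) (z : ℕ × List ℕ × ℕ × ℕ) =>
      ¬ z.2.1.getD e 0 < position e z.1 ∨
        (z.2.2.1 < position e z.2.2.2 ∧ position e z.1 < position e (z.2.1.getD z.1 0)) := by
    have hj : Primrec fun a : ℕ × ℕ × List ℕ × ℕ × ℕ => a.2.1 := Primrec.fst.comp Primrec.snd
    have hq : Primrec fun a : ℕ × ℕ × List ℕ × ℕ × ℕ => a.2.2 := Primrec.snd.comp Primrec.snd
    have hu := Primrec.fst.comp hq
    have hm := Primrec.fst.comp (Primrec.snd.comp hq)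
    have hs := Primrec.snd.comp (Primrec.snd.comp hq)
    have hp := primrec_position.comp Primrec.fst hj
    exact (Primrec.nat_lt.comp ((Primrec.list_getD 0).comp hu Primrec.fst) hp).not.or
      ((Primrec.nat_lt.comp hm (primrec_position.comp Primrec.fst hs)).and
        (Primrec.nat_lt.comp hp (primrec_position.comp Primrec.fst
          ((Primrec.list_getD 0).comp hu hj))))
  have h₁ : PrimrecPred fun z : ℕ × List ℕ × ℕ × ℕ => ∀ e < z.1 + 1,
      ¬ z.2.1.getD e 0 < position e z.1 ∨
        (z.2.2.1 < position e z.2.2.2 ∧ position e z.1 < position e (z.2.1.getD z.1 0)) :=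
    (primrecRel_forall_lt h₀).comp (Primrec.succ.comp Primrec.fst) Primrec.id
  refine ((primrecRel_forall_lt h₁.primrecRel).comp (Primrec.list_length.comp Primrec.fst)
    Primrec.id).of_eq fun q => ?_
  simp only [Harmless, imp_iff_not_or, id]

/-- Finite prefixes of an outgrowing sequence are harmless at late stages. -/
theorem Outgrows.exists_harmless {G : Baire}
    (hG : Outgrows (fun x => {e | e ≤ x}) position G) {u : List ℕ} (hu : G ∈ cylinder u) (m : ℕ) :
    ∃ s, Harmless u m s := by
  have key : ∀ e, ∃ s, (¬ ∃ B, ∀ t, position e t ≤ B) → m < position e s := by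
    intro e
    by_cases h : ∃ B, ∀ t, position e t ≤ B
    · exact ⟨0, fun h' => absurd h h'⟩
    · push Not at h
      obtain ⟨s, hs⟩ := h m
      exact ⟨s, fun _ => hs⟩
  choose σ hσ using key
  refine ⟨(Finset.range u.length).sup σ, fun j hj e he hlt => ?_⟩
  rw [getD_of_mem_cylinder hu (by omega)] at hlt
  rw [getD_of_mem_cylinder hu hj]
  have hnb : ¬ ∃ B, ∀ t, position e t ≤ B := fun hB =>
    absurd ((hG e e (Set.mem_ofPred.2 le_rfl)).1 hB j) (not_le.2 hlt)
  refine ⟨(hσ e hnb).trans_le (position_mono e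
    (Finset.le_sup (f := σ) (Finset.mem_range.2 (by omega)))), (hG j e (by simp; omega)).2 ?_⟩
  by_contra! hB
  exact hnb ⟨_, hB⟩

/-- A harmless finite sequence, continued by an outgrowing one, does not settle below `m`.
Approximations that accept the continuation with a witness within `u` exceed `m` or do not rest for
long enough, and all others fail as they do for the outgrowing sequence. -/
theorem Outgrows.exists_not_settles {G : Baire}
    (hG : Outgrows (fun x => {e | e ≤ x}) position G) {u : List ℕ} {m s : ℕ}
    (h : Harmless u m s) :
    ∃ g ∈ cylinder u, ∀ y, ¬ Settles Exceeds position m g y := by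
  refine ⟨fun i => if i < u.length then u.getD i 0 else G i, ?_, ?_⟩
  · rw [mem_cylinder_iff]
    intro i hi
    simp [hi]
  rintro ⟨e, j, t, t'⟩ ⟨⟨⟨hej, h₁⟩, hjt, h₂⟩, h₃, -, h₄, h₅⟩
  simp only [Encodable.encode_nat] at *
  by_cases ht : t < u.length
  · simp only [ht, if_true] at h₃
    rw [if_pos (by omega)] at h₁
    have := (h t ht e (by omega) (h₁.trans_le (position_mono e hjt))).2
    exact absurd (this.trans_le (position_mono e h₃)) (by simp [h₄])
  · rw [if_neg ht] at h₃
    have hb := hG.le_of_rest position_mono (e := e) (x := t) (by simp; omega) h₃ h₄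
    by_cases hj : j < u.length
    · rw [if_pos (by omega)] at h₁
      have := (h j hj e (by omega) h₁).1
      have := hb s
      omega
    · rw [if_neg hj] at h₂
      exact absurd ((hG j e hej).1 ⟨_, hb⟩ t) (not_le.2 h₂)

/-- Unbounded search for a solution of a decidable condition. -/
theorem exists_search {α β : Type*} [Primcodable α] [Primcodable β] {S : α → β → Prop}
    (hS : PrimrecRel S) :
    ∃ σ : α →. β, Partrec σ ∧ ∀ a, (∃ b, S a b) → ∃ b ∈ σ a, S a b := by
  classical
  have hc : Primrec₂ fun (a : α) (n : ℕ) => (Encodable.decode (α := β) n).bind fun b =>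
      if S a b then some b else none := by
    refine Primrec.option_bind (Primrec.decode.comp Primrec.snd) ?_
    exact Primrec.ite (hS.comp (Primrec.fst.comp Primrec.fst) Primrec.snd)
      (Primrec.option_some.comp Primrec.snd) (Primrec.const none)
  refine ⟨_, Partrec.rfindOpt hc.to_comp, fun a ⟨b, hb⟩ => ?_⟩
  have hdom : (Nat.rfindOpt fun n => (Encodable.decode (α := β) n).bind fun b =>
      if S a b then some b else none).Dom :=
    Nat.rfindOpt_dom.2 ⟨Encodable.encode b, b, by simp [hb]⟩
  refine ⟨_, Part.get_mem hdom, ?_⟩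
  obtain ⟨n, hn⟩ := Nat.rfindOpt_spec (Part.get_mem hdom)
  obtain ⟨b', -, hb'⟩ := Option.bind_eq_some_iff.1 hn
  split_ifs at hb' with h
  exact Option.some.inj hb' ▸ h

theorem exists_markovComputable_not_kComputable :
    ∃ F : ComputablePoint powerNaming → ComputablePoint openNaming,
      MarkovComputable powerNaming openNaming F ∧ ¬ KComputable powerNaming openNaming F := by
  have hPp := primrecPred_exceeds
  have hA : ∀ {e A}, MarkovName powerNaming e A →
      ∀ n, (∃ s, n ≤ position e s) ↔ ∀ i < n, i ∈ A := fun h _ => exists_le_position_iff h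
  -- besides what settles, the index `e` lists what its own approximations accept
  obtain ⟨l, hl, el⟩ := exists_listing (P := ℕ) (β := ℕ × ℕ × ℕ × ℕ × ℕ)
    (R := fun e g y => Accepts Exceeds position g e y.2.2.1 y.2.2.2.1 ∨
      Settles Exceeds position (position e y.1) g y.2)
    (b := fun e y => max e (max y.2.1 y.2.2.2.1) + 1)
    (by
      have hy : Primrec fun a : ℕ × ℕ × ℕ × ℕ × ℕ × ℕ => a.2.2 := Primrec.snd.comp Primrec.snd
      exact Primrec.succ.comp (Primrec.nat_max.comp Primrec.fst (Primrec.nat_max.comp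
        (Primrec.fst.comp hy) (Primrec.fst.comp (Primrec.snd.comp (Primrec.snd.comp hy))))))
    (by
      have hy : Primrec fun a : ℕ × List ℕ × ℕ × ℕ × ℕ × ℕ × ℕ => a.2.2 :=
        Primrec.snd.comp Primrec.snd
      have hu : Primrec fun a : ℕ × List ℕ × ℕ × ℕ × ℕ × ℕ × ℕ => a.2.1 :=
        Primrec.fst.comp Primrec.snd
      have hjs := Primrec.snd.comp (Primrec.snd.comp hy)
      exact (primrecPred_accepts hPp primrec_position hu Primrec.fst (Primrec.fst.comp hjs)
        (Primrec.fst.comp (Primrec.snd.comp hjs))).or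
        (primrecPred_settles hPp primrec_position
          (primrec_position.comp Primrec.fst (Primrec.fst.comp hy)) hu (Primrec.snd.comp hy)))
    (by
      rintro e y g g' h (hg | hg)
      · exact Or.inl (hg.congr fun i hi => h i (by simp at hi; omega))
      · exact Or.inr (hg.congr fun i hi => h i (by simp at hi; omega)))
  have hL : ∀ (e : ℕ) (A : Set ℕ), MarkovName powerNaming e A → ∀ g,
      (∃ n u, l e n = Encodable.encode u + 1 ∧ g ∈ cylinder u) ↔
        g ∈ target Exceeds position A := by
    intro e A he g
    rw [el]
    constructor
    · rintro ⟨y, h | h⟩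
      · exact mem_target_of_accepts position_mono (hA he) h
      · exact Or.inr ⟨_, (hA he _).1 ⟨_, le_rfl⟩, _, h⟩
    · rintro (rfl | ⟨m, hm, y, hy⟩)
      · obtain ⟨j, hj⟩ := (hA (n := g e + 1) he).2 fun _ _ => Set.mem_univ _
        obtain ⟨s, hs⟩ := (hA (n := g (max e j) + 1) he).2 fun _ _ => Set.mem_univ _
        refine ⟨(0, 0, max e j, max (max e j) s, 0), Or.inl ⟨⟨le_max_left _ _, ?_⟩,
          le_max_left _ _, ?_⟩⟩
        · exact Nat.lt_of_succ_le (hj.trans (position_mono e (le_max_right _ _)))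
        · exact Nat.lt_of_succ_le (hs.trans (position_mono e (le_max_right _ _)))
      · obtain ⟨t, ht⟩ := (hA he _).2 hm
        exact ⟨(t, y), Or.inr (hy.mono ht)⟩
  let F := toOpens (fun x : ComputablePoint powerNaming => target Exceeds position x.1) (by
    intro x
    obtain ⟨f, hf, hx⟩ := x.2
    obtain ⟨s, -, hs⟩ := exists_index (P := Unit) (ψ := fun _ n => Part.some (f n))
      (hf.comp Computable.snd).partrec
    exact ⟨l (s ()), (hl.comp (Primrec.const _) Primrec.id).to_comp,
      hL _ _ ⟨f, fun n => by simp [hs], hx⟩⟩)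
  refine ⟨F, ?_, ?_⟩
  · obtain ⟨s, hs, es⟩ := exists_index (ψ := fun e n => Part.some (l e n)) hl.to_comp.partrec
    exact ⟨fun e => Part.some (s e), Partrec.nat_iff.1 hs.to_comp.partrec, fun e x hx =>
      ⟨s e, Part.mem_some _, l e, fun n => by simp [es], fun g => (hL e _ hx g).symm⟩⟩
  rintro ⟨Φ, hΦ, hF⟩
  obtain ⟨G, hG⟩ := exists_outgrows position_mono Set.finite_le_nat
  -- the machine `c`: on a word of length `d`, it searches for a harmless sequence `u` that is listed
  -- on the input `k, segmentName m`, where `k = d + d`, and then computes `segmentName m`; for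
  -- `d > c` its programs are no longer than `k`
  obtain ⟨ψ, hψ, eψ⟩ := hΦ.exists_partrec (P := ℕ × ℕ)
    (partrec_prefixed Computable.fst (H := fun (q : ℕ × ℕ) n => Part.some (segmentName q.2 n))
      (primrec_segmentName.comp (Primrec.snd.comp Primrec.fst) Primrec.snd).to_comp.partrec)
  have eψ' : ∀ k m n, ψ (k, m) n = Φ (prefixed k (segmentName m)) n := fun k m =>
    eψ (k, m) _ (by rintro (_ | n) <;> exact Part.mem_some _)
  obtain ⟨a, ha, ea⟩ := exists_index hψ
  let S : ℕ → List ℕ × ℕ × ℕ × ℕ × ℕ → Prop := fun k z =>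
    Nat.Partrec.Code.evaln z.2.2.2.1 (Denumerable.ofNat _ (a (k, z.2.1))) (z.2.2.2.2 + 1) =
      some (Encodable.encode z.1 + 1) ∧ Harmless z.1 z.2.1 z.2.2.1
  have hS : PrimrecRel S := by
    have hz : Primrec fun q : ℕ × List ℕ × ℕ × ℕ × ℕ × ℕ => q.2 := Primrec.snd
    have hu := Primrec.fst.comp hz
    have hm := Primrec.fst.comp (Primrec.snd.comp hz)
    have hs := Primrec.fst.comp (Primrec.snd.comp (Primrec.snd.comp hz))
    have htn := Primrec.snd.comp (Primrec.snd.comp (Primrec.snd.comp hz))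
    exact (Primrec.eq.comp (Nat.Partrec.Code.primrec_evaln.comp
      (((Primrec.fst.comp htn).pair ((Primrec.ofNat _).comp (ha.comp (Primrec.fst.pair hm)))).pair
        (Primrec.succ.comp (Primrec.snd.comp htn))))
      (Primrec.option_some.comp (Primrec.succ.comp (Primrec.encode.comp hu)))).and
      (primrecPred_harmless.comp (hu.pair (hm.pair hs)))
  obtain ⟨σ, hσ, eσ⟩ := exists_search hS
  have hM : Partrec₂ fun (v : List Bool) (n : ℕ) =>
      (σ (v.length + v.length)).map fun z => segmentName z.2.1 n := by
    have hlen : Computable fun q : List Bool × ℕ => q.1.length :=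
      Computable.list_length.comp Computable.fst
    exact Partrec.map (hσ.comp (Primrec.nat_add.to_comp.comp hlen hlen))
      (primrec_segmentName.to_comp.comp
        (Computable.fst.comp (Computable.snd.comp Computable.snd))
        (Computable.snd.comp Computable.fst))
  obtain ⟨c, hc⟩ := exists_machine hM
  obtain ⟨K, hK⟩ := allNumbers.exists_complexity_le
  let d := max (c + 1) K
  have hcd : c + 1 ≤ d := le_max_left _ _
  have hKd : complexity powerNaming allNumbers.1 ≤ (d + d : ℕ) :=
    hK.trans (by exact_mod_cast (le_max_right (c + 1) K).trans (Nat.le_add_left d d))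
  -- the search is successful, because prefixes of `G` are harmless
  have hex : ∃ z, S (d + d) z := by
    obtain ⟨g, hg, -, hgU⟩ := hF (prefixed (d + d) id) allNumbers
      (kName_prefixed.2 ⟨hKd, powerNaming_id⟩)
    obtain ⟨n, u, hn, hu⟩ := (hgU G).1 (Or.inl rfl)
    have hv : Encodable.encode u + 1 ∈ Φ (prefixed (d + d) id) (n + 1) := hn ▸ hg (n + 1)
    obtain ⟨N, hN⟩ := hΦ.exists_use hv
    obtain ⟨m, hm⟩ := exists_segmentName_eq N
    have hv' : Encodable.encode u + 1 ∈ phi (a (d + d, m)) (n + 1) := by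
      rw [ea, eψ']
      refine hN _ ?_
      rintro (_ | i) hi
      · rfl
      · exact hm m le_rfl i (by omega)
    obtain ⟨t, ht⟩ := Nat.Partrec.Code.evaln_complete.1 hv'
    obtain ⟨s, hs⟩ := hG.exists_harmless hu m
    exact ⟨(u, m, s, t, n), ht, hs⟩
  obtain ⟨⟨u, m, s, t, n⟩, hz, hev, hs⟩ := eσ _ hex
  have hcm : complexity powerNaming (initialSegment m).1 ≤ (d + d : ℕ) := by
    refine complexity_le_iff.2 ⟨programOf c (List.replicate d true),
      ⟨segmentName m, fun n => ?_, powerNaming_segmentName m⟩, ?_⟩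
    · rw [hc, List.length_replicate]
      exact Part.mem_map (fun z : List ℕ × ℕ × ℕ × ℕ × ℕ => segmentName z.2.1 n) hz
    · rw [length_programOf, List.length_replicate]
      omega
  obtain ⟨g, hg, -, hgU⟩ := hF (prefixed (d + d) (segmentName m)) (initialSegment m)
    (kName_prefixed.2 ⟨hcm, powerNaming_segmentName m⟩)
  obtain ⟨g', hg'u, hg'⟩ := hG.exists_not_settles hs
  have hv : Encodable.encode u + 1 ∈ Φ (prefixed (d + d) (segmentName m)) (n + 1) := by
    rw [← eψ', ← ea]
    exact Nat.Partrec.Code.evaln_sound hev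
  have : g' ∈ target Exceeds position (Set.Iio m) :=
    (hgU g').2 ⟨n, u, Part.mem_unique (hg (n + 1)) hv, hg'u⟩
  obtain ⟨y, hy⟩ := mem_target_Iio this
  exact hg' y hy

end NamedSpaces

/-- For functions from the c.e. sets to the effective open subsets of Baire space, Type-2
computability implies K-computability, which implies Markov computability, and neither implication
can be reversed. -/
theorem mainTheorem4 :
    (∀ F : NamedSpaces.ComputablePoint NamedSpaces.powerNaming →
          NamedSpaces.ComputablePoint NamedSpaces.openNaming,
        NamedSpaces.KComputable NamedSpaces.powerNaming NamedSpaces.openNaming F →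
          NamedSpaces.MarkovComputable NamedSpaces.powerNaming NamedSpaces.openNaming F) ∧
    (∃ F : NamedSpaces.ComputablePoint NamedSpaces.powerNaming →
          NamedSpaces.ComputablePoint NamedSpaces.openNaming,
        NamedSpaces.MarkovComputable NamedSpaces.powerNaming NamedSpaces.openNaming F ∧
          ¬ NamedSpaces.KComputable NamedSpaces.powerNaming NamedSpaces.openNaming F) ∧
    (∀ F : NamedSpaces.ComputablePoint NamedSpaces.powerNaming →
          NamedSpaces.ComputablePoint NamedSpaces.openNaming,
        NamedSpaces.Type2Computable NamedSpaces.powerNaming NamedSpaces.openNaming F →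
          NamedSpaces.KComputable NamedSpaces.powerNaming NamedSpaces.openNaming F) ∧
    (∃ F : NamedSpaces.ComputablePoint NamedSpaces.powerNaming →
          NamedSpaces.ComputablePoint NamedSpaces.openNaming,
        NamedSpaces.KComputable NamedSpaces.powerNaming NamedSpaces.openNaming F ∧
          ¬ NamedSpaces.Type2Computable NamedSpaces.powerNaming NamedSpaces.openNaming F) := by
  exact ⟨fun _ h => h.markovComputable, NamedSpaces.exists_markovComputable_not_kComputable,
    fun _ h => h.kComputable, NamedSpaces.exists_kComputable_not_type2Computable⟩
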